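/- Let $n\ge 1$ and let $\mathcal K_0$ be the set of compact convex sets $K\subset\mathbb R^n$ with the origin in their interior. For $K\in\mathcal K_0$ let $|K|$ be its volume, $K^\circ=\{y:\langle x,y\rangle\le 1\ \forall x\in K\}$ its polar body, $h_K(u)=\max_{x\in K}\langle x,u\rangle$ its support function, and $S(K,\cdot)$ its surface area measure on $S^{n-1}$, i.e. the image of the $(n-1)$-dimensional Hausdorff measure on $\partial K$ under the almost everywhere defined map that sends a boundary point with exactly one outer unit normal to that normal. For $p\in\mathbb R$ and $K,Q\in\mathcal K_0$ put $$V_p(K,Q)=\frac1n\int_{S^{n-1}}h_Q(u)^p\,h_K(u)^{1-p}\,dS(K,u),$$ and define the $L_p$ geominimal surface area of $K$ by $$\tilde G_p(K)=\inf_{Q\in\mathcal K_0}\Big\{n\,V_p(K,Q)^{\frac n{n+p}}|Q^\circ|^{\frac p{n+p}}\Big\}\ \ (p\ge 0),\qquad \tilde G_p(K)=\sup_{Q\in\mathcal K_0}\Big\{n\,V_p(K,Q)^{\frac n{n+p}}|Q^\circ|^{\frac p{n+p}}\Big\}\ \ (-n\ne p<0),$$ where the supremum is taken in $[0,\infty]$.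 Then, for every $K\in\mathcal K_0$: (i) if $p\ge 0$, then $\tilde G_p(K)\le n|K|^{\frac n{n+p}}|K^\circ|^{\frac p{n+p}}$; (ii) if $p<0$ and $p\ne -n$, then $\tilde G_p(K)\ge n|K|^{\frac n{n+p}}|K^\circ|^{\frac p{n+p}}$. -/

import Mathlib

open MeasureTheory

noncomputable section

namespace LpGeominimal

/-- The class `𝒦₀` of convex bodies of `ℝⁿ` (compact convex sets) with the origin in their
interior. -/
def BodiesWithOrigin (n : ℕ) : Set (ConvexBody (EuclideanSpace ℝ (Fin n))) :=
  {K | (0 : EuclideanSpace ℝ (Fin n)) ∈ interior (K : Set (EuclideanSpace ℝ (Fin n)))}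

/-- The polar `K° = {y : ⟪x, y⟫ ≤ 1 for all x ∈ K}`. -/
def polarBody {n : ℕ} (K : ConvexBody (EuclideanSpace ℝ (Fin n))) :
    Set (EuclideanSpace ℝ (Fin n)) :=
  {y | ∀ x ∈ K, inner ℝ x y ≤ 1}

/-- The support function `h_K(u) = max {⟪x, u⟫ : x ∈ K}` (the maximum exists, `K` being compact
and nonempty). -/
def supportFun {n : ℕ} (K : ConvexBody (EuclideanSpace ℝ (Fin n)))
    (u : EuclideanSpace ℝ (Fin n)) : ℝ :=
  sSup ((fun x => inner ℝ x u) '' (K : Set (EuclideanSpace ℝ (Fin n))))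

/-- The hyperplane through `x` orthogonal to the unit vector `u` supports `K` at `x`, with
outer unit normal `u`. -/
def IsOuterNormal {n : ℕ} (K : ConvexBody (EuclideanSpace ℝ (Fin n)))
    (x : EuclideanSpace ℝ (Fin n))
    (u : Metric.sphere (0 : EuclideanSpace ℝ (Fin n)) 1) : Prop :=
  ∀ y ∈ K, inner ℝ y (u : EuclideanSpace ℝ (Fin n)) ≤ inner ℝ x (u : EuclideanSpace ℝ (Fin n))

/-- The regular (smooth) boundary points of `K`: those with exactly one outer unit normal.
The other boundary points of a body with interior points form a set of `(n-1)`-dimensional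
Hausdorff measure zero. -/
def regularBoundary {n : ℕ} (K : ConvexBody (EuclideanSpace ℝ (Fin n))) :
    Set (EuclideanSpace ℝ (Fin n)) :=
  {x | x ∈ frontier (K : Set (EuclideanSpace ℝ (Fin n))) ∧ ∃! u, IsOuterNormal K x u}

/-- The Gauss map, which sends a regular boundary point to its outer unit normal. -/
def gaussMap {n : ℕ} (K : ConvexBody (EuclideanSpace ℝ (Fin n))) (x : regularBoundary K) :
    Metric.sphere (0 : EuclideanSpace ℝ (Fin n)) 1 :=
  x.2.2.choose

/-- The surface area measure `S(K, ·)` on `Sⁿ⁻¹`: the image under the Gauss map of the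
`(n-1)`-dimensional Hausdorff measure (normalized so as to agree with Lebesgue measure on
`ℝⁿ⁻¹`) on the boundary of `K`. See `surfaceAreaMeasure_apply` for the explicit formula. -/
def surfaceAreaMeasure {n : ℕ} (K : ConvexBody (EuclideanSpace ℝ (Fin n))) :
    Measure (Metric.sphere (0 : EuclideanSpace ℝ (Fin n)) 1) :=
  Measure.map (gaussMap K)
    (Measure.comap Subtype.val (μHE[n - 1] : Measure (EuclideanSpace ℝ (Fin n))))

/-- The `p`-surface area measure `dS_p(K, u) = h_K(u) ^ (1 - p) dS(K, u)`. -/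
def pSurfaceAreaMeasure {n : ℕ} (p : ℝ) (K : ConvexBody (EuclideanSpace ℝ (Fin n))) :
    Measure (Metric.sphere (0 : EuclideanSpace ℝ (Fin n)) 1) :=
  (surfaceAreaMeasure K).withDensity
    fun u => ENNReal.ofReal (supportFun K (u : EuclideanSpace ℝ (Fin n)) ^ (1 - p))

/-- The `p`-mixed volume `V_p(K, Q) = (1/n) ∫_{Sⁿ⁻¹} h_Q(u) ^ p dS_p(K, u)`. -/
def pMixedVolume {n : ℕ} (p : ℝ) (K Q : ConvexBody (EuclideanSpace ℝ (Fin n))) : ENNReal :=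
  (n : ENNReal)⁻¹ *
    ∫⁻ u, ENNReal.ofReal (supportFun Q (u : EuclideanSpace ℝ (Fin n)) ^ p)
      ∂(pSurfaceAreaMeasure p K)

/-- The `L_p` geominimal surface area: the infimum (for `p ≥ 0`), respectively the supremum
(for `-n ≠ p < 0`), over `Q ∈ 𝒦₀` of `n V_p(K, Q) ^ (n/(n+p)) |Q°| ^ (p/(n+p))`. The supremum may
be infinite, so the value is an extended nonnegative real. -/
def geominimal {n : ℕ} (p : ℝ) (K : ConvexBody (EuclideanSpace ℝ (Fin n))) : ENNReal :=
  if 0 ≤ p then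
    ⨅ Q ∈ BodiesWithOrigin n,
      (n : ENNReal) * pMixedVolume p K Q ^ ((n : ℝ) / (n + p)) *
        volume (polarBody Q) ^ (p / (n + p))
  else
    ⨆ Q ∈ BodiesWithOrigin n,
      (n : ENNReal) * pMixedVolume p K Q ^ ((n : ℝ) / (n + p)) *
        volume (polarBody Q) ^ (p / (n + p))

/-! The next facts show that the constructions above are not degenerate: the Gauss map is
Borel on a Borel set, so that the image measure has the expected explicit description. -/

theorem isClosed_isOuterNormal {n : ℕ} (K : ConvexBody (EuclideanSpace ℝ (Fin n))) :
    IsClosed {q : EuclideanSpace ℝ (Fin n) × Metric.sphere (0 : EuclideanSpace ℝ (Fin n)) 1 |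
      IsOuterNormal K q.1 q.2} := by
  simp only [IsOuterNormal, Set.ofPred_forall]
  refine isClosed_iInter fun y => isClosed_iInter fun _ => isClosed_le ?_ ?_ <;> fun_prop

theorem isCompact_frontier_body {n : ℕ} (K : ConvexBody (EuclideanSpace ℝ (Fin n))) :
    IsCompact (frontier (K : Set (EuclideanSpace ℝ (Fin n)))) :=
  K.isCompact.of_isClosed_subset isClosed_frontier K.isClosed.frontier_subset

theorem isClosed_normals_in {n : ℕ} (K : ConvexBody (EuclideanSpace ℝ (Fin n)))
    {C : Set (Metric.sphere (0 : EuclideanSpace ℝ (Fin n)) 1)} (hC : IsClosed C) :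
    IsClosed {x | x ∈ frontier (K : Set (EuclideanSpace ℝ (Fin n))) ∧
      ∃ u ∈ C, IsOuterNormal K x u} := by
  have h : IsCompact ((frontier (K : Set (EuclideanSpace ℝ (Fin n))) ×ˢ C) ∩
      {q | IsOuterNormal K q.1 q.2}) :=
    ((isCompact_frontier_body K).prod hC.isCompact).inter_right (isClosed_isOuterNormal K)
  convert (h.image continuous_fst).isClosed using 1
  ext x
  constructor
  · rintro ⟨hx, u, hu, hn⟩
    exact ⟨(x, u), ⟨⟨hx, hu⟩, hn⟩, rfl⟩
  · rintro ⟨⟨x', u⟩, ⟨⟨hx, hu⟩, hn⟩, rfl⟩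
    exact ⟨hx, u, hu, hn⟩

theorem measurableSet_regularBoundary {n : ℕ} (K : ConvexBody (EuclideanSpace ℝ (Fin n))) :
    MeasurableSet (regularBoundary K) := by
  have h1 := (isClosed_normals_in K isClosed_univ).measurableSet
  have h2 : ∀ k : ℕ, IsClosed {x | ∃ u v : Metric.sphere (0 : EuclideanSpace ℝ (Fin n)) 1,
      x ∈ frontier (K : Set (EuclideanSpace ℝ (Fin n))) ∧ IsOuterNormal K x u ∧
        IsOuterNormal K x v ∧ 1 / ((k : ℝ) + 1) ≤ dist u v} := by
    intro k
    let T : Set (EuclideanSpace ℝ (Fin n) × (Metric.sphere (0 : EuclideanSpace ℝ (Fin n)) 1 ×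
        Metric.sphere (0 : EuclideanSpace ℝ (Fin n)) 1)) :=
      (frontier (K : Set (EuclideanSpace ℝ (Fin n))) ×ˢ Set.univ) ∩
        ({q | IsOuterNormal K q.1 q.2.1} ∩ ({q | IsOuterNormal K q.1 q.2.2} ∩
          {q | 1 / ((k : ℝ) + 1) ≤ dist q.2.1 q.2.2}))
    have hT : IsCompact T := by
      refine ((isCompact_frontier_body K).prod isCompact_univ).inter_right ?_
      refine IsClosed.inter ?_ (IsClosed.inter ?_ ?_)
      · exact (isClosed_isOuterNormal K).preimage
          (f := fun q : EuclideanSpace ℝ (Fin n) ×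
            (Metric.sphere (0 : EuclideanSpace ℝ (Fin n)) 1 ×
              Metric.sphere (0 : EuclideanSpace ℝ (Fin n)) 1) => (q.1, q.2.1)) (by fun_prop)
      · exact (isClosed_isOuterNormal K).preimage
          (f := fun q : EuclideanSpace ℝ (Fin n) ×
            (Metric.sphere (0 : EuclideanSpace ℝ (Fin n)) 1 ×
              Metric.sphere (0 : EuclideanSpace ℝ (Fin n)) 1) => (q.1, q.2.2)) (by fun_prop)
      · exact isClosed_le continuous_const (by fun_prop)
    convert (hT.image continuous_fst).isClosed using 1
    ext x
    constructor
    · rintro ⟨u, v, hx, hu, hv, hd⟩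
      exact ⟨(x, u, v), ⟨⟨hx, trivial⟩, hu, hv, hd⟩, rfl⟩
    · rintro ⟨⟨x', u, v⟩, ⟨⟨hx, _⟩, hu, hv, hd⟩, rfl⟩
      exact ⟨u, v, hx, hu, hv, hd⟩
  convert h1.diff (MeasurableSet.iUnion fun k => (h2 k).measurableSet) using 1
  ext x
  simp only [regularBoundary, Set.mem_ofPred_eq, Set.mem_sdiff, Set.mem_univ, true_and,
    Set.mem_iUnion, not_exists]
  constructor
  · rintro ⟨hx, u, hu, huniq⟩
    refine ⟨⟨hx, u, hu⟩, ?_⟩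
    rintro k v w ⟨-, hv, hw, hd⟩
    rw [huniq v hv, huniq w hw, dist_self] at hd
    exact absurd hd (not_le.mpr (by positivity))
  · rintro ⟨⟨hx, u, hu⟩, hk⟩
    refine ⟨hx, u, hu, fun v hv => ?_⟩
    by_contra hne
    obtain ⟨k, hlt⟩ := exists_nat_one_div_lt (dist_pos.mpr hne)
    exact hk k v u ⟨hx, hv, hu, hlt.le⟩

theorem gaussMap_spec {n : ℕ} (K : ConvexBody (EuclideanSpace ℝ (Fin n)))
    (x : regularBoundary K) : IsOuterNormal K x (gaussMap K x) :=
  x.2.2.choose_spec.1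

theorem gaussMap_eq {n : ℕ} (K : ConvexBody (EuclideanSpace ℝ (Fin n)))
    (x : regularBoundary K) (u : Metric.sphere (0 : EuclideanSpace ℝ (Fin n)) 1)
    (hu : IsOuterNormal K x u) : gaussMap K x = u :=
  (x.2.2.choose_spec.2 u hu).symm

theorem continuous_gaussMap {n : ℕ} (K : ConvexBody (EuclideanSpace ℝ (Fin n))) :
    Continuous (gaussMap K) := by
  refine continuous_iff_isClosed.mpr fun C hC => ?_
  convert (isClosed_normals_in K hC).preimage
    (continuous_subtype_val : Continuous (Subtype.val : regularBoundary K → _)) using 1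
  ext x
  constructor
  · intro hx
    exact ⟨x.2.1, gaussMap K x, hx, gaussMap_spec K x⟩
  · rintro ⟨-, u, hu, hn⟩
    simpa [gaussMap_eq K x u hn] using hu

/-- `S(K, A)` is the `(n-1)`-dimensional Hausdorff measure of the set of (regular) boundary points
at which `K` has a supporting hyperplane with outer normal in `A`. -/
theorem surfaceAreaMeasure_apply {n : ℕ} (K : ConvexBody (EuclideanSpace ℝ (Fin n)))
    {A : Set (Metric.sphere (0 : EuclideanSpace ℝ (Fin n)) 1)} (hA : MeasurableSet A) :
    surfaceAreaMeasure K A = (μHE[n - 1] : Measure (EuclideanSpace ℝ (Fin n)))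
      {x | x ∈ regularBoundary K ∧ ∃ u ∈ A, IsOuterNormal K x u} := by
  have hm := (continuous_gaussMap K).measurable
  rw [surfaceAreaMeasure, Measure.map_apply hm hA,
    (MeasurableEmbedding.subtype_coe (measurableSet_regularBoundary K)).comap_apply]
  congr 1
  ext x
  constructor
  · rintro ⟨y, hy, rfl⟩
    exact ⟨y.2, gaussMap K y, hy, gaussMap_spec K y⟩
  · rintro ⟨hx, u, hu, hn⟩
    refine ⟨⟨x, hx⟩, ?_, rfl⟩
    change gaussMap K ⟨x, hx⟩ ∈ A
    rwa [gaussMap_eq K ⟨x, hx⟩ u hn]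

end LpGeominimal

end

/-! The body `K` itself is an admissible competitor `Q` in the infimum or supremum, so both
inequalities follow once `V_p(K, K) = |K|`. Since `h_K ^ p * h_K ^ (1 - p) = h_K`, this is the
cone-volume formula `∫ h_K dS(K, ·) = n |K|`, which carries no power `p` and is where all the work
lies.

At a regular boundary point `x` with outer normal `u`, put `w x = u / ⟪x, u⟫`. Then `⟪w x, x⟫ = 1`,
`⟪w x, ·⟫ ≤ 1` on `K`, and `‖w x‖⁻¹ = h_K(u)`. The formula becomes `∫ ‖w x‖⁻¹ dH^(n-1) = n |cone|`
over the regular boundary (`lintegral_inv_norm_eq_volume_coneOver`).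

For a base in a hyperplane this is Fubini. In general the boundary is cut into countably many pieces
on which `w` is within relative error `ε` of a fixed vector `w₀`. On each piece a homogeneous map
that differs from the identity by an `ε`-Lipschitz map flattens the piece and its cone
simultaneously (`exists_flattening`), so both sides change only by powers of `1 ± ε`. Summing over
the pieces and letting `ε → 0` gives the formula.

Finally, the cone over the regular boundary fills `K` up to a null set, by Rademacher's theorem for
the gauge (`volume_coneOver_regularBoundary`). -/

/-- The punctured cone `{t • x : 0 < t ≤ 1, x ∈ A}` with base `A` and apex `0`. -/
def coneOver {E : Type*} [SMul ℝ E] (A : Set E) : Set E :=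
  (fun q : ℝ × E => q.1 • q.2) '' (Set.Ioc 0 1 ×ˢ A)

theorem mem_coneOver {E : Type*} [SMul ℝ E] {A : Set E} {z : E} :
    z ∈ coneOver A ↔ ∃ t : ℝ, 0 < t ∧ t ≤ 1 ∧ ∃ x ∈ A, t • x = z := by
  simp only [coneOver, Set.mem_image, Set.mem_prod, Set.mem_Ioc, Prod.exists]
  constructor
  · rintro ⟨t, x, ⟨⟨h0, h1⟩, hx⟩, rfl⟩
    exact ⟨t, h0, h1, x, hx, rfl⟩
  · rintro ⟨t, h0, h1, x, hx, rfl⟩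
    exact ⟨t, x, ⟨⟨h0, h1⟩, hx⟩, rfl⟩

/-! ### Hausdorff measure under small Lipschitz perturbations of the identity -/

theorem LipschitzOnWith.euclideanHausdorffMeasure_image_le {X Y : Type*}
    [EMetricSpace X] [MeasurableSpace X] [BorelSpace X]
    [EMetricSpace Y] [MeasurableSpace Y] [BorelSpace Y] {C : NNReal} {f : X → Y} {s : Set X}
    (h : LipschitzOnWith C f s) (d : ℕ) :
    (μHE[d] : Measure Y) (f '' s) ≤ (C : ENNReal) ^ d * (μHE[d] : Measure X) s := by
  have := h.hausdorffMeasure_image_le (d := d) (by positivity)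
  rw [ENNReal.rpow_natCast] at this
  simp only [Measure.euclideanHausdorffMeasure_def, Measure.smul_apply, ENNReal.smul_def,
    smul_eq_mul]
  rw [mul_left_comm]
  gcongr

theorem euclideanHausdorffMeasure_image_le_of_near_isometry {E : Type*}
    [NormedAddCommGroup E] [MeasurableSpace E] [BorelSpace E] {F : E → E} {S : Set E} {ε : ℝ}
    (h0 : 0 ≤ ε) (h : ∀ x ∈ S, ∀ y ∈ S, ‖F x - F y - (x - y)‖ ≤ ε * ‖x - y‖) (d : ℕ) :
    (μHE[d] : Measure E) (F '' S) ≤ ENNReal.ofReal (1 + ε) ^ d * (μHE[d] : Measure E) S := by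
  refine LipschitzOnWith.euclideanHausdorffMeasure_image_le (C := (1 + ε).toNNReal) ?_ d
  refine LipschitzOnWith.of_dist_le_mul fun x hx y hy => ?_
  rw [dist_eq_norm, dist_eq_norm, Real.coe_toNNReal _ (by positivity)]
  have h1 := norm_add_le (F x - F y - (x - y)) (x - y)
  rw [sub_add_cancel] at h1
  linarith [h x hx y hy]

theorem one_sub_mul_norm_le_of_near_isometry {E : Type*} [NormedAddCommGroup E]
    {F : E → E} {ε : ℝ} {x y : E}
    (h : ‖F x - F y - (x - y)‖ ≤ ε * ‖x - y‖) : (1 - ε) * ‖x - y‖ ≤ ‖F x - F y‖ := by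
  have h1 := norm_sub_le (F x - F y) (F x - F y - (x - y))
  rw [sub_sub_cancel] at h1
  linarith

theorem injOn_of_near_isometry {E : Type*} [NormedAddCommGroup E]
    {F : E → E} {S : Set E} {ε : ℝ} (h1 : ε < 1)
    (h : ∀ x ∈ S, ∀ y ∈ S, ‖F x - F y - (x - y)‖ ≤ ε * ‖x - y‖) : Set.InjOn F S := by
  intro x hx y hy hxy
  have := one_sub_mul_norm_le_of_near_isometry (h x hx y hy)
  rw [hxy, sub_self, norm_zero] at this
  have h2 : ‖x - y‖ ≤ 0 := nonpos_of_mul_nonpos_right this (by linarith)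
  exact sub_eq_zero.mp (norm_le_zero_iff.mp h2)

/-- For `ε < 1` the map is injective on `S` and its inverse is `(1 - ε)⁻¹`-Lipschitz on the image;
the Lipschitz bound is applied to that inverse. -/
theorem le_euclideanHausdorffMeasure_image_of_near_isometry {E : Type*}
    [NormedAddCommGroup E] [MeasurableSpace E] [BorelSpace E] {F : E → E} {S : Set E} {ε : ℝ}
    (h1 : ε < 1) (h : ∀ x ∈ S, ∀ y ∈ S, ‖F x - F y - (x - y)‖ ≤ ε * ‖x - y‖) (d : ℕ) :
    ENNReal.ofReal (1 - ε) ^ d * (μHE[d] : Measure E) S ≤ (μHE[d] : Measure E) (F '' S) := by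
  have hpos : 0 < 1 - ε := by linarith
  have hinj := injOn_of_near_isometry h1 h
  have hL : LipschitzOnWith ((1 - ε)⁻¹).toNNReal (Function.invFunOn F S) (F '' S) := by
    refine LipschitzOnWith.of_dist_le_mul ?_
    rintro _ ⟨x, hx, rfl⟩ _ ⟨y, hy, rfl⟩
    rw [hinj.leftInvOn_invFunOn hx, hinj.leftInvOn_invFunOn hy, dist_eq_norm, dist_eq_norm,
      Real.coe_toNNReal _ (by positivity), inv_mul_eq_div, le_div_iff₀ hpos, mul_comm]
    exact one_sub_mul_norm_le_of_near_isometry (h x hx y hy)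
  have h2 := hL.euclideanHausdorffMeasure_image_le d
  rw [hinj.leftInvOn_invFunOn.image_image] at h2
  calc _ ≤ ENNReal.ofReal (1 - ε) ^ d * (ENNReal.ofReal ((1 - ε)⁻¹) ^ d *
        (μHE[d] : Measure E) (F '' S)) := by gcongr; exact h2
    _ = _ := by
      rw [← mul_assoc, ← mul_pow, ← ENNReal.ofReal_mul hpos.le, mul_inv_cancel₀ hpos.ne']
      simp

/-! ### Cones over flat bases -/

theorem lintegral_Ioc_pow (m : ℕ) :
    ((m + 1 : ℕ) : ENNReal) * ∫⁻ x in Set.Ioc (0 : ℝ) 1, ENNReal.ofReal x ^ m = 1 := by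
  have h : ∫⁻ x in Set.Ioc (0 : ℝ) 1, ENNReal.ofReal x ^ m =
      ENNReal.ofReal (((m : ℝ) + 1)⁻¹) := by
    have h1 : ∫⁻ x in Set.Ioc (0 : ℝ) 1, ENNReal.ofReal x ^ m =
        ∫⁻ x in Set.Ioc (0 : ℝ) 1, ENNReal.ofReal (x ^ m) :=
      setLIntegral_congr_fun measurableSet_Ioc fun x hx => (ENNReal.ofReal_pow hx.1.le m).symm
    rw [h1, ← ofReal_integral_eq_lintegral_ofReal]
    · rw [← intervalIntegral.integral_of_le zero_le_one, integral_pow]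
      simp
    · exact ((continuous_pow m).intervalIntegrable 0 1).1
    · exact (ae_restrict_iff' measurableSet_Ioc).2 (ae_of_all _ fun x hx => pow_nonneg hx.1.le m)
  rw [h, ← ENNReal.ofReal_natCast, ← ENNReal.ofReal_mul (by positivity)]
  push_cast
  rw [mul_inv_cancel₀ (by positivity), ENNReal.ofReal_one]

section Cone

variable {E : Type*} [NormedAddCommGroup E] [InnerProductSpace ℝ E] [FiniteDimensional ℝ E]
  [MeasurableSpace E] [BorelSpace E]

/-- The function `g` recovers `t` from `t • x`, so `(t, x) ↦ t • x` is injective on the product, and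
an injective continuous image of a Borel set is Borel. For a convex body `g` is the gauge; for a
flat base it is a linear functional. -/
theorem measurableSet_coneOver {A : Set E} (hA : MeasurableSet A) {g : E → ℝ}
    (hg : ∀ x ∈ A, ∀ t : ℝ, 0 < t → g (t • x) = t) : MeasurableSet (coneOver A) := by
  refine (measurableSet_Ioc.prod hA).image_of_continuousOn_injOn (by fun_prop) ?_
  rintro ⟨t, x⟩ ⟨ht, hx⟩ ⟨s, y⟩ ⟨hs, hy⟩ h
  simp only at h ht hs hx hy
  have hts : t = s := by rw [← hg x hx t ht.1, h, hg y hy s hs.1]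
  subst hts
  exact Prod.ext rfl (smul_right_injective E ht.1.ne' h)

open scoped Pointwise in
/-- The volume of a cone whose base lies in the hyperplane `⟪·, w⟫ = 1`. -/
theorem volume_coneOver_of_subset_hyperplane {n : ℕ} (hn : Module.finrank ℝ E = n) (h1 : 1 ≤ n)
    {w : E} (hw : w ≠ 0) {B : Set E} (hB : MeasurableSet B) (hBw : ∀ b ∈ B, inner ℝ w b = 1) :
    (n : ENNReal) * volume (coneOver B) =
      ENNReal.ofReal ‖w‖⁻¹ * (μHE[n - 1] : Measure E) B := by
  have hw' : 0 < ‖w‖ := norm_pos_iff.mpr hw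
  -- With this scaling `⟪w, x • v⟫ = x`, so the slice of the cone at parameter `x` is `x • B`, and
  -- `‖v‖ = ‖w‖⁻¹` is the Jacobian of the slicing formula.
  set v : E := (‖w‖ ^ 2)⁻¹ • w with hv
  have hv0 : v ≠ 0 := smul_ne_zero (by positivity) hw
  have hvw : ∀ x : ℝ, inner ℝ w (x • v) = x := fun x => by
    rw [hv, real_inner_smul_right, real_inner_smul_right, real_inner_self_eq_norm_sq,
      inv_mul_cancel₀ (by positivity), mul_one]
  have hnv : ‖v‖ₑ = ENNReal.ofReal ‖w‖⁻¹ := by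
    rw [← ofReal_norm, hv, norm_smul, norm_inv, norm_pow, norm_norm]
    congr 1
    field_simp
  have hC : MeasurableSet (coneOver B) := measurableSet_coneOver hB (g := fun y => inner ℝ w y)
    fun x hx t _ => by simp [real_inner_smul_right, hBw x hx]
  have hslice : ∀ x : ℝ, coneOver B ∩ AffineSubspace.mk' (x • v +ᵥ (0 : E)) (Submodule.span ℝ {v})ᗮ
      = if x ∈ Set.Ioc (0 : ℝ) 1 then x • B else ∅ := by
    intro x
    have hmem : ∀ y, y ∈ (AffineSubspace.mk' (x • v +ᵥ (0 : E)) (Submodule.span ℝ {v})ᗮ : Set E) ↔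
        inner ℝ w y = x := by
      intro y
      rw [SetLike.mem_coe, AffineSubspace.mem_mk', Submodule.mem_orthogonal_singleton_iff_inner_right]
      simp only [vsub_eq_sub, vadd_eq_add, add_zero]
      nth_rw 1 [hv]
      rw [real_inner_smul_left, inner_sub_right, hvw]
      constructor
      · intro h
        rcases mul_eq_zero.mp h with h | h
        · exact absurd h (by positivity)
        · linarith
      · intro h
        rw [h, sub_self, mul_zero]
    ext y
    rw [Set.mem_inter_iff, hmem, mem_coneOver]
    split_ifs with hx
    · rw [Set.mem_smul_set]
      constructor
      · rintro ⟨⟨t, ht0, ht1, b, hb, rfl⟩, h⟩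
        rw [real_inner_smul_right, hBw b hb, mul_one] at h
        exact ⟨b, hb, by rw [h]⟩
      · rintro ⟨b, hb, rfl⟩
        exact ⟨⟨x, hx.1, hx.2, b, hb, rfl⟩, by rw [real_inner_smul_right, hBw b hb, mul_one]⟩
    · simp only [Set.mem_empty_iff_false, iff_false]
      rintro ⟨⟨t, ht0, ht1, b, hb, rfl⟩, h⟩
      rw [real_inner_smul_right, hBw b hb, mul_one] at h
      exact hx ⟨h ▸ ht0, h ▸ ht1⟩
  have hint : ∫⁻ x : ℝ, (μHE[n - 1] : Measure E) (coneOver B ∩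
      AffineSubspace.mk' (x • v +ᵥ (0 : E)) (Submodule.span ℝ {v})ᗮ) =
      (∫⁻ x in Set.Ioc (0 : ℝ) 1, ENNReal.ofReal x ^ (n - 1)) * (μHE[n - 1] : Measure E) B := by
    rw [← lintegral_mul_const _ (by fun_prop), ← lintegral_indicator measurableSet_Ioc]
    congr 1 with x
    rw [hslice]
    by_cases hx : x ∈ Set.Ioc (0 : ℝ) 1
    · rw [if_pos hx, Set.indicator_of_mem hx, Measure.euclideanHausdorffMeasure_smul₀ _ hx.1.ne',
        ENNReal.smul_def, smul_eq_mul, ENNReal.coe_pow]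
      congr 2
      rw [← enorm_eq_nnnorm, ← ofReal_norm, Real.norm_of_nonneg hx.1.le]
    · rw [if_neg hx, Set.indicator_of_notMem hx, measure_empty]
  have h2 := EuclideanGeometry.euclideanHausdorffMeasure_eq_lintegral (0 : E) hv0 hC
  rw [InnerProductSpace.euclideanHausdorffMeasure_eq_volume, hn, hint, hnv] at h2
  obtain ⟨m, rfl⟩ : ∃ m, n = m + 1 := ⟨n - 1, by omega⟩
  rw [h2, mul_left_comm, ← mul_assoc (((m + 1 : ℕ) : ENNReal)), Nat.add_sub_cancel,
    lintegral_Ioc_pow, one_mul]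

end Cone

/-! ### Flattening a hypersurface together with its cone -/

/-- The hypersurface `A` is flattened onto the hyperplane `⟪w₀, ·⟫ = 1` by a nearly isometric
homogeneous map, if its normalized normals are close to `w₀`. -/
theorem exists_flattening {E : Type*} [NormedAddCommGroup E] [InnerProductSpace ℝ E]
    {A : Set E} {w : E → E} {g : E → ℝ} (hgc : Continuous g)
    (hg : ∀ x ∈ A, ∀ t : ℝ, 0 < t → g (t • x) = t)
    (hw1 : ∀ x ∈ A, inner ℝ (w x) x = 1) (hw2 : ∀ x ∈ A, ∀ y ∈ A, inner ℝ (w x) y ≤ 1)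
    {w₀ : E} (hw₀ : w₀ ≠ 0) {ε : ℝ} (hε : ∀ x ∈ A, ‖w x - w₀‖ ≤ ε * ‖w₀‖) :
    ∃ F : E → E, Continuous F ∧ (∀ x ∈ A, inner ℝ w₀ (F x) = 1) ∧
      F '' coneOver A = coneOver (F '' A) ∧
      ∀ x ∈ A ∪ coneOver A, ∀ y ∈ A ∪ coneOver A, ‖F x - F y - (x - y)‖ ≤ ε * ‖x - y‖ := by
  have hpos : 0 < ‖w₀‖ := norm_pos_iff.mpr hw₀
  have hg1 : ∀ x ∈ A, g x = 1 := fun x hx => by simpa using hg x hx 1 one_pos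
  -- The point is moved along `w₀` until `⟪w₀, ·⟫` takes the value `g z`. This value is `1` on `A`,
  -- and the map is positively homogeneous on the rays through `A`, so cones go to cones.
  refine ⟨fun z => z - (inner ℝ w₀ z - g z) • (‖w₀‖ ^ 2)⁻¹ • w₀, by fun_prop, ?_, ?_, ?_⟩
  · intro x hx
    rw [inner_sub_right, real_inner_smul_right, real_inner_smul_right, real_inner_self_eq_norm_sq,
      inv_mul_cancel₀ (by positivity), hg1 x hx]
    ring
  · have hF : ∀ x ∈ A, ∀ t : ℝ, 0 < t → t • x - (inner ℝ w₀ (t • x) - g (t • x)) •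
        (‖w₀‖ ^ 2)⁻¹ • w₀ = t • (x - (inner ℝ w₀ x - g x) • (‖w₀‖ ^ 2)⁻¹ • w₀) := by
      intro x hx t ht
      rw [hg x hx t ht, hg1 x hx, real_inner_smul_right, smul_sub, smul_smul t]
      congr 2
      ring
    ext z
    simp only [Set.mem_image, mem_coneOver]
    constructor
    · rintro ⟨_, ⟨t, h0, h1, x, hx, rfl⟩, rfl⟩
      exact ⟨t, h0, h1, _, ⟨x, hx, rfl⟩, (hF x hx t h0).symm⟩
    · rintro ⟨t, h0, h1, _, ⟨x, hx, rfl⟩, rfl⟩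
      exact ⟨_, ⟨t, h0, h1, x, hx, rfl⟩, hF x hx t h0⟩
  · have hrep : ∀ z ∈ A ∪ coneOver A, ∃ t : ℝ, 0 < t ∧ ∃ x ∈ A, t • x = z := by
      rintro z (hz | hz)
      · exact ⟨1, one_pos, z, hz, one_smul _ _⟩
      · obtain ⟨t, h0, -, h⟩ := mem_coneOver.mp hz
        exact ⟨t, h0, h⟩
    -- For `z = s • x` and `z' = t • y`, the support inequality at `y` gives `⟪w y, z - z'⟫ ≤ s - t
    -- = g z - g z'`. Hence the increment of `⟪w₀, ·⟫ - g` is at most `⟪w₀ - w y, z - z'⟫`, which is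
    -- small because `w y` is close to `w₀`. Exchanging the points bounds the absolute value.
    have key : ∀ x ∈ A ∪ coneOver A, ∀ y ∈ A ∪ coneOver A,
        (inner ℝ w₀ x - g x) - (inner ℝ w₀ y - g y) ≤ ε * ‖w₀‖ * ‖x - y‖ := by
      intro z hz z' hz'
      obtain ⟨s, hs, x, hx, rfl⟩ := hrep z hz
      obtain ⟨t, ht, y, hy, rfl⟩ := hrep z' hz'
      rw [hg x hx s hs, hg y hy t ht]
      have h1 : inner ℝ (w y) (s • x - t • y) ≤ s - t := by
        rw [inner_sub_right, real_inner_smul_right, real_inner_smul_right, hw1 y hy]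
        nlinarith [hw2 y hy x hx]
      have h2 : inner ℝ (w₀ - w y) (s • x - t • y) ≤ ε * ‖w₀‖ * ‖s • x - t • y‖ := by
        refine (real_inner_le_norm _ _).trans ?_
        rw [norm_sub_rev]
        gcongr
        exact hε y hy
      rw [inner_sub_left, inner_sub_right] at h2
      linarith
    intro x hx y hy
    have h1 : |(inner ℝ w₀ x - g x) - (inner ℝ w₀ y - g y)| ≤ ε * ‖w₀‖ * ‖x - y‖ := by
      rw [abs_le]
      have := key y hy x hx
      rw [norm_sub_rev] at this
      exact ⟨by linarith, key x hx y hy⟩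
    have h2 : x - (inner ℝ w₀ x - g x) • (‖w₀‖ ^ 2)⁻¹ • w₀ -
        (y - (inner ℝ w₀ y - g y) • (‖w₀‖ ^ 2)⁻¹ • w₀) - (x - y) =
        -(((inner ℝ w₀ x - g x) - (inner ℝ w₀ y - g y)) • (‖w₀‖ ^ 2)⁻¹ • w₀) := by
      module
    rw [h2, norm_neg, norm_smul, norm_smul, norm_inv, norm_pow, norm_norm, Real.norm_eq_abs]
    have h3 : (‖w₀‖ ^ 2)⁻¹ * ‖w₀‖ = ‖w₀‖⁻¹ := by field_simp
    rw [h3, ← div_eq_mul_inv, div_le_iff₀ hpos]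
    linarith

section Cone

variable {E : Type*} [NormedAddCommGroup E] [InnerProductSpace ℝ E] [FiniteDimensional ℝ E]
  [MeasurableSpace E] [BorelSpace E]

/-- Flattening reduces the claim to a flat base, at the cost of near-isometry factors in dimension
`n` for the cone and `n - 1` for the base, and of replacing `‖w x‖` by `‖w₀‖`. -/
theorem cone_volume_comparison {n : ℕ} (hn : Module.finrank ℝ E = n) (h1 : 1 ≤ n)
    {A : Set E} (hA : MeasurableSet A) {w : E → E} {g : E → ℝ} (hgc : Continuous g)
    (hg : ∀ x ∈ A, ∀ t : ℝ, 0 < t → g (t • x) = t)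
    (hw1 : ∀ x ∈ A, inner ℝ (w x) x = 1) (hw2 : ∀ x ∈ A, ∀ y ∈ A, inner ℝ (w x) y ≤ 1)
    {w₀ : E} (hw₀ : w₀ ≠ 0) {ε : ℝ} (h0 : 0 ≤ ε) (hε1 : ε < 1)
    (hε : ∀ x ∈ A, ‖w x - w₀‖ ≤ ε * ‖w₀‖) :
    ENNReal.ofReal (1 - ε) ^ n * ∫⁻ x in A, ENNReal.ofReal ‖w x‖⁻¹ ∂(μHE[n - 1] : Measure E) ≤
        ENNReal.ofReal (1 + ε) ^ n * (n * volume (coneOver A)) ∧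
      ENNReal.ofReal (1 - ε) ^ n * (n * volume (coneOver A)) ≤
        ENNReal.ofReal (1 + ε) ^ n *
          ∫⁻ x in A, ENNReal.ofReal ‖w x‖⁻¹ ∂(μHE[n - 1] : Measure E) := by
  obtain ⟨F, hFc, hFw, hFC, hF⟩ := exists_flattening hgc hg hw1 hw2 hw₀ hε
  have hpos : 0 < ‖w₀‖ := norm_pos_iff.mpr hw₀
  have hA' : ∀ x ∈ A, ∀ y ∈ A, ‖F x - F y - (x - y)‖ ≤ ε * ‖x - y‖ :=
    fun x hx y hy => hF x (Or.inl hx) y (Or.inl hy)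
  have hC' : ∀ x ∈ coneOver A, ∀ y ∈ coneOver A, ‖F x - F y - (x - y)‖ ≤ ε * ‖x - y‖ :=
    fun x hx y hy => hF x (Or.inr hx) y (Or.inr hy)
  have hFA : MeasurableSet (F '' A) :=
    hA.image_of_continuousOn_injOn hFc.continuousOn (injOn_of_near_isometry hε1 hA')
  have hflat := volume_coneOver_of_subset_hyperplane hn h1 hw₀ hFA
    (by rintro _ ⟨x, hx, rfl⟩; exact hFw x hx)
  have hCle := euclideanHausdorffMeasure_image_le_of_near_isometry h0 hC' n
  have hCge := le_euclideanHausdorffMeasure_image_of_near_isometry hε1 hC' n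
  have hvol : (μHE[n] : Measure E) = volume := by
    rw [← hn, InnerProductSpace.euclideanHausdorffMeasure_eq_volume]
  rw [hvol, hFC] at hCle hCge
  have hAle := euclideanHausdorffMeasure_image_le_of_near_isometry h0 hA' (n - 1)
  have hAge := le_euclideanHausdorffMeasure_image_of_near_isometry hε1 hA' (n - 1)
  set H := (μHE[n - 1] : Measure E)
  -- Of the `n` factors on the integral side, `n - 1` come from the measure of the base and one from
  -- comparing `‖w x‖` with `‖w₀‖`.
  have hsplit : ∀ c : ENNReal, c ^ n = c ^ (n - 1) * c := fun c => by
    rw [← pow_succ, Nat.sub_add_cancel h1]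
  have hup : ENNReal.ofReal (1 - ε) * ∫⁻ x in A, ENNReal.ofReal ‖w x‖⁻¹ ∂H ≤
      ENNReal.ofReal ‖w₀‖⁻¹ * H A := by
    have hm : 0 < 1 - ε := by linarith
    calc _ ≤ ENNReal.ofReal (1 - ε) * ∫⁻ x in A, ENNReal.ofReal ((1 - ε)⁻¹ * ‖w₀‖⁻¹) ∂H := by
          refine mul_le_mul' le_rfl ?_
          refine setLIntegral_mono' hA fun x hx => ENNReal.ofReal_le_ofReal ?_
          rw [← mul_inv]
          refine inv_anti₀ (by positivity) ?_
          have := norm_sub_norm_le w₀ (w x)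
          rw [norm_sub_rev] at this
          linarith [hε x hx]
      _ = _ := by
          rw [setLIntegral_const, ← mul_assoc, ← ENNReal.ofReal_mul hm.le,
            mul_inv_cancel_left₀ hm.ne']
  have hlow : ENNReal.ofReal ‖w₀‖⁻¹ * H A ≤
      ENNReal.ofReal (1 + ε) * ∫⁻ x in A, ENNReal.ofReal ‖w x‖⁻¹ ∂H := by
    have hm : 0 < 1 + ε := by linarith
    calc _ = ENNReal.ofReal (1 + ε) * ∫⁻ x in A, ENNReal.ofReal ((1 + ε)⁻¹ * ‖w₀‖⁻¹) ∂H := by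
          rw [setLIntegral_const, ← mul_assoc, ← ENNReal.ofReal_mul hm.le,
            mul_inv_cancel_left₀ hm.ne']
      _ ≤ _ := by
          refine mul_le_mul' le_rfl ?_
          refine setLIntegral_mono' hA fun x hx => ENNReal.ofReal_le_ofReal ?_
          rw [← mul_inv]
          have hwx : 0 < ‖w x‖ := by
            rw [norm_pos_iff]
            intro h
            have := hw1 x hx
            rw [h, inner_zero_left] at this
            exact zero_ne_one this
          refine inv_anti₀ hwx ?_
          have := norm_sub_norm_le (w x) w₀
          linarith [hε x hx]
  constructor
  · calc _ = ENNReal.ofReal (1 - ε) ^ (n - 1) *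
          (ENNReal.ofReal (1 - ε) * ∫⁻ x in A, ENNReal.ofReal ‖w x‖⁻¹ ∂H) := by
          rw [hsplit, mul_assoc]
      _ ≤ ENNReal.ofReal (1 - ε) ^ (n - 1) * (ENNReal.ofReal ‖w₀‖⁻¹ * H A) := by gcongr
      _ = ENNReal.ofReal ‖w₀‖⁻¹ * (ENNReal.ofReal (1 - ε) ^ (n - 1) * H A) := by ring
      _ ≤ ENNReal.ofReal ‖w₀‖⁻¹ * H (F '' A) := by gcongr
      _ = n * volume (coneOver (F '' A)) := hflat.symm
      _ ≤ n * (ENNReal.ofReal (1 + ε) ^ n * volume (coneOver A)) := by gcongr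
      _ = _ := by ring
  · calc _ = n * (ENNReal.ofReal (1 - ε) ^ n * volume (coneOver A)) := by ring
      _ ≤ n * volume (coneOver (F '' A)) := by gcongr
      _ = ENNReal.ofReal ‖w₀‖⁻¹ * H (F '' A) := hflat
      _ ≤ ENNReal.ofReal ‖w₀‖⁻¹ * (ENNReal.ofReal (1 + ε) ^ (n - 1) * H A) := by gcongr
      _ = ENNReal.ofReal (1 + ε) ^ (n - 1) * (ENNReal.ofReal ‖w₀‖⁻¹ * H A) := by ring
      _ ≤ ENNReal.ofReal (1 + ε) ^ (n - 1) *
          (ENNReal.ofReal (1 + ε) * ∫⁻ x in A, ENNReal.ofReal ‖w x‖⁻¹ ∂H) := by gcongr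
      _ = _ := by rw [← mul_assoc, ← hsplit]

/-! ### Summation over small pieces and the limit `ε → 0` -/

theorem ENNReal.le_of_forall_one_sub_pow_mul_le {a b : ENNReal} (n : ℕ)
    (h : ∀ ε : ℝ, 0 < ε → ε < 1 →
      ENNReal.ofReal (1 - ε) ^ n * a ≤ ENNReal.ofReal (1 + ε) ^ n * b) : a ≤ b := by
  have hlim : ∀ (c : ℝ) (x : ENNReal), Filter.Tendsto
      (fun ε : ℝ => ENNReal.ofReal (1 + c * ε) ^ n * x) (nhdsWithin 0 (Set.Ioi 0)) (nhds x) := by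
    intro c x
    have h1 : Filter.Tendsto (fun ε : ℝ => ENNReal.ofReal (1 + c * ε) ^ n)
        (nhdsWithin 0 (Set.Ioi 0)) (nhds 1) := by
      have : Continuous fun ε : ℝ => ENNReal.ofReal (1 + c * ε) ^ n :=
        (ENNReal.continuous_pow n).comp (ENNReal.continuous_ofReal.comp (by fun_prop))
      simpa using (this.tendsto 0).mono_left nhdsWithin_le_nhds
    simpa using ENNReal.Tendsto.mul_const h1 (Or.inl one_ne_zero)
  refine le_of_tendsto_of_tendsto (hlim (-1) a) (hlim 1 b) ?_
  filter_upwards [Ioo_mem_nhdsGT (zero_lt_one (α := ℝ))] with ε hε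
  have := h ε hε.1 hε.2
  rwa [neg_one_mul, ← sub_eq_add_neg, one_mul]

/-- The cone-volume formula over a hypersurface `A` with normals `w x` normalized by
`⟪w x, x⟫ = 1`, if `A` lies in all the half-spaces `⟪w x, ·⟫ ≤ 1`. -/
theorem lintegral_inv_norm_eq_volume_coneOver {n : ℕ} (hn : Module.finrank ℝ E = n) (h1 : 1 ≤ n)
    {A : Set E} (hA : MeasurableSet A) {w : E → E} (hwm : ContinuousOn w A)
    {g : E → ℝ} (hgc : Continuous g) (hg : ∀ x ∈ A, ∀ t : ℝ, 0 < t → g (t • x) = t)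
    (hw1 : ∀ x ∈ A, inner ℝ (w x) x = 1) (hw2 : ∀ x ∈ A, ∀ y ∈ A, inner ℝ (w x) y ≤ 1) :
    ∫⁻ x in A, ENNReal.ofReal ‖w x‖⁻¹ ∂(μHE[n - 1] : Measure E) = n * volume (coneOver A) := by
  have main : ∀ ε : ℝ, 0 < ε → ε < 1 →
      ENNReal.ofReal (1 - ε) ^ n *
          ∫⁻ x in A, ENNReal.ofReal ‖w x‖⁻¹ ∂(μHE[n - 1] : Measure E) ≤
          ENNReal.ofReal (1 + ε) ^ n * (n * volume (coneOver A)) ∧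
        ENNReal.ofReal (1 - ε) ^ n * (n * volume (coneOver A)) ≤
          ENNReal.ofReal (1 + ε) ^ n *
            ∫⁻ x in A, ENNReal.ofReal ‖w x‖⁻¹ ∂(μHE[n - 1] : Measure E) := by
    intro ε h0 hε1
    let d : ℕ → E := TopologicalSpace.denseSeq E
    let T : ℕ → Set E := fun i => A ∩ {x | d i ≠ 0 ∧ ‖w x - d i‖ ≤ ε * ‖d i‖}
    have hT : ∀ i, MeasurableSet (T i) := by
      intro i
      by_cases hi : d i = 0
      · simp [T, hi]
      · have h2 : ContinuousOn (fun x => ‖w x - d i‖) A := by fun_prop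
        obtain ⟨C, hC, hCA⟩ := continuousOn_iff_isClosed.mp h2 (Set.Iic (ε * ‖d i‖)) isClosed_Iic
        have : T i = C ∩ A := by
          rw [← hCA]
          ext x
          simp [T, hi, and_comm]
        rw [this]
        exact hC.measurableSet.inter hA
    let D := disjointed T
    have hDT : ∀ i, D i ⊆ T i := disjointed_subset T
    have hDA : ∀ i, D i ⊆ A := fun i => (hDT i).trans Set.inter_subset_left
    have hD : ∀ i, MeasurableSet (D i) := MeasurableSet.disjointed hT
    have hdisj : Pairwise (Function.onFun Disjoint D) := disjoint_disjointed T
    have hU : ⋃ i, D i = A := by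
      rw [iUnion_disjointed]
      refine Set.Subset.antisymm (Set.iUnion_subset fun i => Set.inter_subset_left) fun x hx => ?_
      have hwx : 0 < ‖w x‖ := by
        rw [norm_pos_iff]
        intro h
        have := hw1 x hx
        rw [h, inner_zero_left] at this
        exact zero_ne_one this
      -- The tolerance `ε * ‖w x‖ / 2` with `ε < 1` forces `‖d i‖ > ‖w x‖ / 2`, so the error is at
      -- most `ε * ‖d i‖`, relative to the centre as required in `T`.
      obtain ⟨i, hi⟩ := (TopologicalSpace.denseRange_denseSeq E).exists_dist_lt (w x)
        (show 0 < ε * ‖w x‖ / 2 by positivity)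
      rw [dist_eq_norm] at hi
      have hdi : ‖w x‖ / 2 < ‖d i‖ := by
        have := norm_sub_norm_le (w x) (d i)
        nlinarith
      refine Set.mem_iUnion.mpr ⟨i, hx, norm_pos_iff.mp (by linarith), hi.le.trans ?_⟩
      rw [mul_div_assoc]
      gcongr
    have hcd : Pairwise (Function.onFun Disjoint fun i => coneOver (D i)) := by
      intro i j hij
      rw [Function.onFun, Set.disjoint_left]
      intro z hz hz'
      obtain ⟨t, ht, -, x, hx, rfl⟩ := mem_coneOver.mp hz
      obtain ⟨s, hs, -, y, hy, hxy⟩ := mem_coneOver.mp hz'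
      have hst : s = t := by rw [← hg y (hDA j hy) s hs, hxy, hg x (hDA i hx) t ht]
      subst hst
      have : y = x := smul_right_injective E hs.ne' hxy
      subst this
      exact Set.disjoint_left.mp (hdisj hij) hx hy
    have hcU : coneOver A = ⋃ i, coneOver (D i) := by
      rw [← hU]
      simp only [coneOver, Set.prod_iUnion, Set.image_iUnion]
    have hcm : ∀ i, MeasurableSet (coneOver (D i)) := fun i =>
      measurableSet_coneOver (hD i) fun x hx => hg x (hDA i hx)
    have hI : ∫⁻ x in A, ENNReal.ofReal ‖w x‖⁻¹ ∂(μHE[n - 1] : Measure E) =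
        ∑' i, ∫⁻ x in D i, ENNReal.ofReal ‖w x‖⁻¹ ∂(μHE[n - 1] : Measure E) := by
      rw [← lintegral_iUnion hD hdisj, hU]
    have hV : n * volume (coneOver A) = ∑' i, n * volume (coneOver (D i)) := by
      rw [hcU, measure_iUnion hcd hcm, ENNReal.tsum_mul_left]
    have hcomp : ∀ i, _ := fun i => by
      by_cases hi : d i = 0
      · have : D i = ∅ := Set.subset_empty_iff.mp ((hDT i).trans (by simp [T, hi]))
        exact (show ENNReal.ofReal (1 - ε) ^ n *
          ∫⁻ x in D i, ENNReal.ofReal ‖w x‖⁻¹ ∂(μHE[n - 1] : Measure E) ≤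
          ENNReal.ofReal (1 + ε) ^ n * (n * volume (coneOver (D i))) ∧
        ENNReal.ofReal (1 - ε) ^ n * (n * volume (coneOver (D i))) ≤
          ENNReal.ofReal (1 + ε) ^ n *
            ∫⁻ x in D i, ENNReal.ofReal ‖w x‖⁻¹ ∂(μHE[n - 1] : Measure E) by
          simp [this, coneOver])
      · exact cone_volume_comparison hn h1 (hD i) hgc (fun x hx => hg x (hDA i hx))
          (fun x hx => hw1 x (hDA i hx)) (fun x hx y hy => hw2 x (hDA i hx) y (hDA i hy)) hi h0.le
          hε1 (fun x hx => (hDT i hx).2.2)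
    rw [hI, hV, ← ENNReal.tsum_mul_left, ← ENNReal.tsum_mul_left, ← ENNReal.tsum_mul_left,
      ← ENNReal.tsum_mul_left]
    exact ⟨ENNReal.tsum_le_tsum fun i => (hcomp i).1, ENNReal.tsum_le_tsum fun i => (hcomp i).2⟩
  exact le_antisymm (ENNReal.le_of_forall_one_sub_pow_mul_le n fun ε h h' => (main ε h h').1)
    (ENNReal.le_of_forall_one_sub_pow_mul_le n fun ε h h' => (main ε h h').2)

end Cone

/-! ### Support function, outer normals and gauge of a convex body -/

noncomputable section
namespace LpGeominimal

variable {n : ℕ} {K : ConvexBody (EuclideanSpace ℝ (Fin n))}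

theorem BodiesWithOrigin.mem_nhds (hK : K ∈ BodiesWithOrigin n) :
    (K : Set (EuclideanSpace ℝ (Fin n))) ∈ nhds 0 :=
  mem_interior_iff_mem_nhds.mp hK

theorem BodiesWithOrigin.exists_pos_smul_mem (hK : K ∈ BodiesWithOrigin n)
    (u : EuclideanSpace ℝ (Fin n)) : ∃ r : ℝ, 0 < r ∧ r • u ∈ K := by
  have h : Filter.Tendsto (fun r : ℝ => r • u) (nhdsWithin 0 (Set.Ioi 0)) (nhds 0) := by
    have : Continuous fun r : ℝ => r • u := by fun_prop
    simpa using (this.tendsto 0).mono_left nhdsWithin_le_nhds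
  obtain ⟨r, hr, hr0⟩ :=
    ((h.eventually (BodiesWithOrigin.mem_nhds hK)).and self_mem_nhdsWithin).exists
  exact ⟨r, hr0, hr⟩

theorem supportFun_eq_of_isOuterNormal {x : EuclideanSpace ℝ (Fin n)} (hx : x ∈ K)
    {u : Metric.sphere (0 : EuclideanSpace ℝ (Fin n)) 1} (h : IsOuterNormal K x u) :
    supportFun K u = inner ℝ x (u : EuclideanSpace ℝ (Fin n)) := by
  refine IsGreatest.csSup_eq ⟨⟨x, hx, rfl⟩, ?_⟩
  rintro _ ⟨y, hy, rfl⟩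
  exact h y hy

theorem continuous_supportFun (K : ConvexBody (EuclideanSpace ℝ (Fin n))) :
    Continuous (supportFun K) :=
  K.isCompact.continuous_sSup (f := fun u x => inner ℝ x u) (by fun_prop)

theorem inner_le_supportFun {x : EuclideanSpace ℝ (Fin n)} (hx : x ∈ K)
    (u : EuclideanSpace ℝ (Fin n)) : inner ℝ x u ≤ supportFun K u :=
  le_csSup (K.isCompact.image (f := fun x => inner ℝ x u) (by fun_prop)).bddAbove ⟨x, hx, rfl⟩

theorem supportFun_pos (hK : K ∈ BodiesWithOrigin n)
    (u : Metric.sphere (0 : EuclideanSpace ℝ (Fin n)) 1) : 0 < supportFun K u := by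
  obtain ⟨r, hr, hru⟩ := BodiesWithOrigin.exists_pos_smul_mem hK (u : EuclideanSpace ℝ (Fin n))
  refine lt_of_lt_of_le ?_ (inner_le_supportFun hru u)
  rw [real_inner_smul_left, real_inner_self_eq_norm_sq, norm_eq_of_mem_sphere]
  simpa using hr

theorem gauge_smul_of_mem_frontier (hK : K ∈ BodiesWithOrigin n) {x : EuclideanSpace ℝ (Fin n)}
    (hx : x ∈ frontier (K : Set (EuclideanSpace ℝ (Fin n)))) {t : ℝ} (ht : 0 < t) :
    gauge (K : Set (EuclideanSpace ℝ (Fin n))) (t • x) = t := by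
  rw [gauge_smul_of_nonneg ht.le,
    (gauge_eq_one_iff_mem_frontier K.convex (BodiesWithOrigin.mem_nhds hK)).mpr hx, smul_eq_mul,
    mul_one]

/-- A functional separating `x` from the open interior gives a weak inequality on its closure, which
contains `K` as the interior is nonempty. -/
theorem exists_isOuterNormal (hK : K ∈ BodiesWithOrigin n) {x : EuclideanSpace ℝ (Fin n)}
    (hx : x ∈ frontier (K : Set (EuclideanSpace ℝ (Fin n)))) : ∃ u, IsOuterNormal K x u := by
  obtain ⟨f, hf⟩ := geometric_hahn_banach_open_point K.convex.interior isOpen_interior hx.2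
  set v := (InnerProductSpace.toDual ℝ (EuclideanSpace ℝ (Fin n))).symm f with hv
  have hfv : ∀ y, f y = inner ℝ y v := fun y => by
    rw [real_inner_comm, hv, InnerProductSpace.toDual_symm_apply]
  have hv0 : 0 < ‖v‖ := by
    rw [norm_pos_iff]
    intro h
    have := hf 0 hK
    simp [hfv, h] at this
  have hle : ∀ y ∈ K, inner ℝ y v ≤ inner ℝ x v := by
    intro y hy
    have hcl : closure (interior (K : Set (EuclideanSpace ℝ (Fin n)))) ⊆ {y | f y ≤ f x} :=
      closure_minimal (fun a ha => (hf a ha).le) (isClosed_le f.continuous continuous_const)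
    rw [K.convex.closure_interior_eq_closure_of_nonempty_interior ⟨0, hK⟩] at hcl
    have := hcl (subset_closure hy)
    rwa [Set.mem_ofPred_eq, hfv, hfv] at this
  refine ⟨⟨‖v‖⁻¹ • v, ?_⟩, fun y hy => ?_⟩
  · rw [mem_sphere_zero_iff_norm, norm_smul, norm_inv, norm_norm, inv_mul_cancel₀ hv0.ne']
  · simp only [real_inner_smul_right]
    exact mul_le_mul_of_nonneg_left (hle y hy) (by positivity)

/-- At a point where the gauge is differentiable, its gradient is the normalized outer normal. -/
theorem inner_eq_mul_fderiv_gauge (hK : K ∈ BodiesWithOrigin n) {x : EuclideanSpace ℝ (Fin n)}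
    (hx : x ∈ frontier (K : Set (EuclideanSpace ℝ (Fin n)))) {t : ℝ} (ht : 0 < t)
    (hd : DifferentiableAt ℝ (gauge (K : Set (EuclideanSpace ℝ (Fin n)))) (t • x))
    {u : Metric.sphere (0 : EuclideanSpace ℝ (Fin n)) 1} (hu : IsOuterNormal K x u)
    (y : EuclideanSpace ℝ (Fin n)) :
    inner ℝ (u : EuclideanSpace ℝ (Fin n)) y =
      supportFun K u * fderiv ℝ (gauge (K : Set (EuclideanSpace ℝ (Fin n)))) (t • x) y := by
  have hxK : x ∈ K := K.isClosed.frontier_subset hx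
  have hpos := supportFun_pos hK u
  have hsup := supportFun_eq_of_isOuterNormal hxK hu
  set g := gauge (K : Set (EuclideanSpace ℝ (Fin n)))
  have hle : ∀ z, inner ℝ (u : EuclideanSpace ℝ (Fin n)) z ≤ supportFun K u * g z := by
    intro z
    have habs : Absorbent ℝ (K : Set (EuclideanSpace ℝ (Fin n))) :=
      absorbent_nhds_zero (BodiesWithOrigin.mem_nhds hK)
    refine le_of_forall_pos_le_add fun δ hδ => ?_
    obtain ⟨r, hr0, hr, hz⟩ := exists_lt_of_gauge_lt habs
      (show g z < g z + δ / supportFun K u by linarith [div_pos hδ hpos])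
    obtain ⟨k, hk, rfl⟩ := hz
    have h1 := inner_le_supportFun hk (u : EuclideanSpace ℝ (Fin n))
    simp only [real_inner_smul_right]
    rw [real_inner_comm]
    calc r * inner ℝ k (u : EuclideanSpace ℝ (Fin n)) ≤ r * supportFun K u := by gcongr
      _ ≤ (g (r • k) + δ / supportFun K u) * supportFun K u := by gcongr
      _ = _ := by field_simp
  -- The function `h_K(u) g - ⟪u, ·⟫` is nonnegative and vanishes at `t • x`, so its derivative
  -- there is zero.
  have hmin : IsLocalMin (fun z => supportFun K u * g z -
      innerSL ℝ (u : EuclideanSpace ℝ (Fin n)) z) (t • x) := by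
    refine Filter.Eventually.of_forall fun z => ?_
    have h1 : supportFun K u * g (t • x) - inner ℝ (u : EuclideanSpace ℝ (Fin n)) (t • x) = 0 := by
      rw [show g (t • x) = t from gauge_smul_of_mem_frontier hK hx ht, hsup, real_inner_smul_right, real_inner_comm]
      ring
    simp only [innerSL_apply_apply]
    rw [h1]
    linarith [hle z]
  have hder := hmin.hasFDerivAt_eq_zero
    ((hd.hasFDerivAt.const_mul (supportFun K u)).sub (innerSL ℝ _).hasFDerivAt)
  have := congrArg (fun L => L y) hder
  simp only [sub_apply, smul_apply, zero_apply, innerSL_apply_apply, smul_eq_mul] at this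
  linarith

/-- Every outer normal at `x` is a positive multiple of the gradient of the gauge, and unit length
leaves only one. -/
theorem mem_regularBoundary_of_differentiableAt_gauge (hK : K ∈ BodiesWithOrigin n)
    {x : EuclideanSpace ℝ (Fin n)}
    (hx : x ∈ frontier (K : Set (EuclideanSpace ℝ (Fin n)))) {t : ℝ} (ht : 0 < t)
    (hd : DifferentiableAt ℝ (gauge (K : Set (EuclideanSpace ℝ (Fin n)))) (t • x)) :
    x ∈ regularBoundary K := by
  obtain ⟨u, hu⟩ := exists_isOuterNormal hK hx
  refine ⟨hx, u, hu, fun v hv => ?_⟩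
  have hu' := inner_eq_mul_fderiv_gauge hK hx ht hd hu
  have hv' := inner_eq_mul_fderiv_gauge hK hx ht hd hv
  have hc : supportFun K v • (u : EuclideanSpace ℝ (Fin n)) =
      supportFun K u • (v : EuclideanSpace ℝ (Fin n)) := by
    refine ext_inner_right ℝ fun y => ?_
    rw [real_inner_smul_left, real_inner_smul_left, hu', hv']
    ring
  have hn := congrArg norm hc
  rw [norm_smul, norm_smul, norm_eq_of_mem_sphere, norm_eq_of_mem_sphere, mul_one, mul_one,
    Real.norm_of_nonneg (supportFun_pos hK v).le,
    Real.norm_of_nonneg (supportFun_pos hK u).le] at hn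
  rw [hn] at hc
  exact Subtype.ext (smul_right_injective _ (supportFun_pos hK u).ne' hc).symm

/-- The gauge is Lipschitz, hence differentiable almost everywhere by Rademacher. A nonzero `z ∈ K`
where it is differentiable is `gauge K z` times a boundary point, which is then regular. Working in
the solid body avoids showing that the singular boundary points are `H^(n-1)`-null. -/
theorem volume_coneOver_regularBoundary (hn : 1 ≤ n) (hK : K ∈ BodiesWithOrigin n) :
    volume (coneOver (regularBoundary K)) = volume (K : Set (EuclideanSpace ℝ (Fin n))) := by
  have hnhds := BodiesWithOrigin.mem_nhds hK
  have : Nonempty (Fin n) := ⟨⟨0, hn⟩⟩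
  refine measure_congr ?_
  have h1 : coneOver (regularBoundary K) ≤ᵐ[volume] (K : Set (EuclideanSpace ℝ (Fin n))) := by
    refine Filter.Eventually.of_forall fun z hz => ?_
    obtain ⟨t, h0, h1, x, hx, rfl⟩ := mem_coneOver.mp hz
    exact K.convex.smul_mem_of_zero_mem (mem_of_mem_nhds hnhds)
      (K.isClosed.frontier_subset hx.1) ⟨h0.le, h1⟩
  refine h1.antisymm ?_
  obtain ⟨C, hC⟩ := K.convex.lipschitz_gauge hnhds
  have hne : ∀ᵐ z : EuclideanSpace ℝ (Fin n), z ≠ 0 := by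
    rw [ae_iff]
    simp
  filter_upwards [hC.ae_differentiableAt (μ := volume), hne] with z hd hz hzK
  have habs := absorbent_nhds_zero (𝕜 := ℝ) hnhds
  have hg0 : 0 < gauge (K : Set (EuclideanSpace ℝ (Fin n))) z :=
    (gauge_pos habs (NormedSpace.isVonNBounded_of_isBounded ℝ K.isCompact.isBounded)).mpr hz
  have hx : (gauge (K : Set (EuclideanSpace ℝ (Fin n))) z)⁻¹ • z ∈
      frontier (K : Set (EuclideanSpace ℝ (Fin n))) := by
    rw [← gauge_eq_one_iff_mem_frontier K.convex hnhds, gauge_smul_of_nonneg (by positivity),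
      smul_eq_mul, inv_mul_cancel₀ hg0.ne']
  have hzx := smul_inv_smul₀ hg0.ne' z
  refine mem_coneOver.mpr ⟨_, hg0, gauge_le_one_of_mem hzK, _, ?_, hzx⟩
  exact mem_regularBoundary_of_differentiableAt_gauge hK hx hg0 (by rwa [hzx])

/-! ### The cone-volume formula and `V_p(K, K) = |K|` -/

open Classical in
/-- The outer unit normal at a regular boundary point `x`, divided by its inner product
with `x`. -/
def polarNormal (K : ConvexBody (EuclideanSpace ℝ (Fin n))) (x : EuclideanSpace ℝ (Fin n)) :
    EuclideanSpace ℝ (Fin n) :=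
  if h : x ∈ regularBoundary K then
    (inner ℝ x (gaussMap K ⟨x, h⟩ : EuclideanSpace ℝ (Fin n)))⁻¹ •
      (gaussMap K ⟨x, h⟩ : EuclideanSpace ℝ (Fin n))
  else 0

theorem inner_gaussMap (x : regularBoundary K) :
    inner ℝ (x : EuclideanSpace ℝ (Fin n)) (gaussMap K x : EuclideanSpace ℝ (Fin n)) =
      supportFun K (gaussMap K x) :=
  (supportFun_eq_of_isOuterNormal (K.isClosed.frontier_subset x.2.1) (gaussMap_spec K x)).symm

theorem polarNormal_coe (x : regularBoundary K) :
    polarNormal K x = (supportFun K (gaussMap K x))⁻¹ •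
      (gaussMap K x : EuclideanSpace ℝ (Fin n)) := by
  rw [polarNormal, dif_pos x.2, inner_gaussMap]

/-- The cone-volume formula for a convex body. -/
theorem lintegral_supportFun_surfaceAreaMeasure (hn : 1 ≤ n) (hK : K ∈ BodiesWithOrigin n) :
    ∫⁻ u, ENNReal.ofReal (supportFun K (u : EuclideanSpace ℝ (Fin n))) ∂(surfaceAreaMeasure K) =
      n * volume (K : Set (EuclideanSpace ℝ (Fin n))) := by
  have hnhds := BodiesWithOrigin.mem_nhds hK
  have hreg := measurableSet_regularBoundary K
  have hsm : Measurable fun u : Metric.sphere (0 : EuclideanSpace ℝ (Fin n)) 1 =>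
      ENNReal.ofReal (supportFun K (u : EuclideanSpace ℝ (Fin n))) :=
    (ENNReal.continuous_ofReal.comp
      ((continuous_supportFun K).comp continuous_subtype_val)).measurable
  have hnorm : ∀ x : regularBoundary K, ‖polarNormal K x‖⁻¹ = supportFun K (gaussMap K x) := by
    intro x
    rw [polarNormal_coe, norm_smul, norm_eq_of_mem_sphere, mul_one, norm_inv, inv_inv,
      Real.norm_of_nonneg (supportFun_pos hK _).le]
  -- Pulled back along the Gauss map, the integrand `h_K` is `‖w x‖⁻¹` for `w = polarNormal K`. The
  -- remaining goals are the continuity of `w` and its two support relations.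
  rw [surfaceAreaMeasure, lintegral_map hsm (continuous_gaussMap K).measurable,
    ← volume_coneOver_regularBoundary hn hK,
    ← lintegral_inv_norm_eq_volume_coneOver (by simp) hn hreg (w := polarNormal K) ?_
      (K.convex.uniformContinuous_gauge hnhds).continuous
      (fun x hx t ht => gauge_smul_of_mem_frontier hK hx.1 ht) ?_ ?_,
    ← lintegral_subtype_comap hreg]
  · simp only [hnorm]
  · rw [continuousOn_iff_continuous_domRestrict]
    have h1 : (regularBoundary K).domRestrict (polarNormal K) = fun x =>
        (supportFun K (gaussMap K x))⁻¹ • (gaussMap K x : EuclideanSpace ℝ (Fin n)) :=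
      funext polarNormal_coe
    rw [h1]
    have h2 := continuous_subtype_val.comp (continuous_gaussMap K)
    exact (((continuous_supportFun K).comp h2).inv₀ fun x => (supportFun_pos hK _).ne').smul h2
  · intro x hx
    rw [polarNormal_coe ⟨x, hx⟩, real_inner_smul_left, real_inner_comm, inner_gaussMap ⟨x, hx⟩,
      inv_mul_cancel₀ (supportFun_pos hK _).ne']
  · intro x hx y hy
    rw [polarNormal_coe ⟨x, hx⟩, real_inner_smul_left, inv_mul_le_one₀ (supportFun_pos hK _),
      real_inner_comm]
    exact inner_le_supportFun (K.isClosed.frontier_subset hy.1) _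

theorem pMixedVolume_self (hn : 1 ≤ n) (hK : K ∈ BodiesWithOrigin n) (p : ℝ) :
    pMixedVolume p K K = volume (K : Set (EuclideanSpace ℝ (Fin n))) := by
  have hm : ∀ q : ℝ, Measurable fun u : Metric.sphere (0 : EuclideanSpace ℝ (Fin n)) 1 =>
      ENNReal.ofReal (supportFun K (u : EuclideanSpace ℝ (Fin n)) ^ q) := fun q =>
    (((continuous_supportFun K).comp continuous_subtype_val).measurable.pow_const q).ennreal_ofReal
  rw [pMixedVolume, pSurfaceAreaMeasure, lintegral_withDensity_eq_lintegral_mul _ (hm _) (hm _)]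
  have h : ∀ u : Metric.sphere (0 : EuclideanSpace ℝ (Fin n)) 1,
      ENNReal.ofReal (supportFun K u ^ (1 - p)) * ENNReal.ofReal (supportFun K u ^ p) =
        ENNReal.ofReal (supportFun K u) := fun u => by
    rw [← ENNReal.ofReal_mul (Real.rpow_nonneg (supportFun_pos hK u).le _),
      ← Real.rpow_add (supportFun_pos hK u), sub_add_cancel, Real.rpow_one]
  simp only [Pi.mul_apply, h]
  rw [lintegral_supportFun_surfaceAreaMeasure hn hK, ← mul_assoc, ENNReal.inv_mul_cancel, one_mul]
  · exact_mod_cast (by omega : n ≠ 0)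
  · exact ENNReal.natCast_ne_top n

end LpGeominimal
end

theorem proposition4p1 (n : ℕ) (hn : 1 ≤ n) (K : ConvexBody (EuclideanSpace ℝ (Fin n)))
    (hK : K ∈ LpGeominimal.BodiesWithOrigin n) (p : ℝ) :
    (0 ≤ p →
      LpGeominimal.geominimal p K ≤
        (n : ENNReal) * volume (K : Set (EuclideanSpace ℝ (Fin n))) ^ ((n : ℝ) / (n + p)) *
          volume (LpGeominimal.polarBody K) ^ (p / (n + p))) ∧
    (p < 0 → p ≠ -(n : ℝ) →
      (n : ENNReal) * volume (K : Set (EuclideanSpace ℝ (Fin n))) ^ ((n : ℝ) / (n + p)) *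
          volume (LpGeominimal.polarBody K) ^ (p / (n + p)) ≤
        LpGeominimal.geominimal p K) := by
  refine ⟨fun hp => ?_, fun hp _ => ?_⟩
  · rw [LpGeominimal.geominimal, if_pos hp]
    refine (iInf₂_le K hK).trans_eq ?_
    rw [LpGeominimal.pMixedVolume_self hn hK]
  · rw [LpGeominimal.geominimal, if_neg hp.not_ge]
    refine le_trans (Eq.le ?_) (le_iSup₂ K hK)
    rw [LpGeominimal.pMixedVolume_self hn hK]
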